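/- Perpetual voting with $k\ge 1$ options, $N$ agents and $T$ rounds is the following game. In each round $r=1,\dots,T$ the Adversary first announces, for every agent $i\in\{1,\dots,N\}$, a set $S^{(r)}_i\subseteq\{1,\dots,k\}$ of options approved by $i$; then the Decision Maker, who sees these sets and all previous moves, picks an option $\theta^{(r)}\in\{1,\dots,k\}$. The dissatisfaction of agent $i$ in a play is the number of rounds $r$ with $\theta^{(r)}\notin S^{(r)}_i$. A set $A$ of agents is in a conflict in round $r$ if there is no option $\theta$ with $\theta\in S^{(r)}_i$ for all $i\in A$. The conflict number of a play is the maximum, over all sets $A$ of at most $k$ agents, of the number of rounds in which $A$ is in a conflict. In $C$-conflict perpetual voting the Adversary must keep the conflict number of the play at most $C$. Theorem. For every $k\ge 1$ there is a constant $W>0$, depending only on $k$, such that for all integers $N,T,C\ge 0$ the Decision Maker has a strategy in $C$-conflict perpetual voting with $k$ options, $N$ agents and $T$ rounds which guarantees that in every play the dissatisfaction of every agent is at most $$T^{1-1/k}\cdot C^{1/k}\cdot\bigl(\ln (N+2)\cdot\ln (C+2)\bigr)^{W},$$ and moreover, whenever $N,C\ge 1$ and $\ln N\cdot\ln C>1$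 (in particular, whenever $N,C\ge 3$), at most $$T^{1-1/k}\cdot C^{1/k}\cdot\bigl(\ln N\cdot\ln C\bigr)^{W}.$$ -/

import Mathlib

namespace PerpetualVoting

/-- The Adversary's move in one round with `k` options and `N` agents: for every agent, the set of
options that this agent approves. -/
abbrev Profile (k N : ℕ) : Type := Fin N → Finset (Fin k)

/-- A play of perpetual voting with `k` options, `N` agents and `T` rounds. -/
structure Play (k N T : ℕ) where
  /-- `approved r i` is the set of options approved by agent `i` in round `r`. -/
  approved : Fin T → Profile k N
  /-- `choice r` is the option picked by the Decision Maker in round `r`. -/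
  choice : Fin T → Fin k

/-- A (deterministic) strategy of the Decision Maker: in round `r`, given the moves of both players
in the preceding rounds and the Adversary's move in round `r`, it picks an option. -/
abbrev Strategy (k N T : ℕ) : Type :=
  (r : Fin T) → (Fin (r : ℕ) → Profile k N × Fin k) → Profile k N → Fin k

namespace Play

variable {k N T : ℕ}

/-- The moves of both players in the rounds preceding `r`. -/
def history (p : Play k N T) (r : Fin T) : Fin (r : ℕ) → Profile k N × Fin k :=
  fun j => (p.approved (j.castLE r.isLt.le), p.choice (j.castLE r.isLt.le))

/-- In the play `p` the Decision Maker follows the strategy `σ`. -/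
def Follows (p : Play k N T) (σ : Strategy k N T) : Prop :=
  ∀ r : Fin T, p.choice r = σ r (p.history r) (p.approved r)

/-- The dissatisfaction of agent `i`: the number of rounds in which the chosen option is not
approved by `i`. -/
def dissatisfaction (p : Play k N T) (i : Fin N) : ℕ :=
  (Finset.univ.filter fun r : Fin T => p.choice r ∉ p.approved r i).card

/-- The set `A` of agents is in a conflict in round `r`: no option is approved by all of `A`. -/
def InConflict (p : Play k N T) (A : Finset (Fin N)) (r : Fin T) : Prop :=
  ¬ ∃ θ : Fin k, ∀ i ∈ A, θ ∈ p.approved r i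

open Classical in
/-- The number of rounds in which the set `A` of agents is in a conflict. -/
noncomputable def conflictRounds (p : Play k N T) (A : Finset (Fin N)) : ℕ :=
  (Finset.univ.filter fun r : Fin T => p.InConflict A r).card

/-- The conflict number of a play: the maximum, over all sets of at most `k` agents, of the number
of rounds in which the set is in a conflict. -/
noncomputable def conflictNumber (p : Play k N T) : ℕ :=
  ((Finset.univ : Finset (Finset (Fin N))).filter fun A => A.card ≤ k).sup p.conflictRounds

end Play

/-- In `C`-conflict perpetual voting (the Adversary has to keep the conflict number of the play at
most `C`) the strategy `σ` guarantees dissatisfaction at most `B` for every agent. -/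
def Strategy.Guarantees {k N T : ℕ} (σ : Strategy k N T) (C : ℕ) (B : ℝ) : Prop :=
  ∀ p : Play k N T, p.Follows σ → p.conflictNumber ≤ C →
    ∀ i : Fin N, (p.dissatisfaction i : ℝ) ≤ B

end PerpetualVoting

/-!
The Decision Maker runs multiplicative weights: agent `i` has the weight `(1 + ε) ^ dᵢ`, where `dᵢ`
is the dissatisfaction of `i` so far, and the option chosen minimises the total weight of the agents
disapproving it.

Let `W` be the total weight at the end and `ℓ r` the total weight of the agents dissatisfied in
round `r`, so that `W = N + ε ∑ ℓ r`. By the choice of the option, `ℓ r ^ k` is at most the product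
over all options `θ` of the weight of the agents disapproving `θ`. Weights only grow, so final weights
may be used instead, and expanding the product gives a sum over `k`-tuples of agents in which the
`θ`-th member disapproves `θ`. Such a tuple is in a conflict, and this happens in at most `C` rounds,
whence `∑ ℓ r ^ k ≤ C W ^ k` (`sum_lostWeight_pow_le`). The power mean inequality turns this into
`∑ ℓ r ≤ B W` with `B = T ^ (1 - 1 / k) C ^ (1 / k)`. If `ε B ≤ 1 / 2`, then `W ≤ N + W / 2`, so
`W ≤ 2 N` and every agent satisfies `(1 + ε) ^ dᵢ ≤ 2 N` (`one_add_pow_dissatisfaction_le`). The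
choice `ε = 1 / (2 B)` yields `dᵢ ≤ 4 B log (2 N)`; constants are absorbed into the exponent, because
`log (N + 2) * log (C + 2)` and `log N * log C` are bounded away from `1` in the relevant ranges.
-/

namespace PerpetualVoting

open Finset

/-- The number of rounds of a history in which the chosen option was not approved by agent `i`. -/
def pastDissatisfaction {k N n : ℕ} (h : Fin n → Profile k N × Fin k) (i : Fin N) : ℕ :=
  (univ.filter fun j : Fin n => (h j).2 ∉ (h j).1 i).card

/-- The total weight, for weights `w` of the agents, of the agents not approving the option `θ`. -/
def disapproval {k N : ℕ} (w : Fin N → ℝ) (S : Profile k N) (θ : Fin k) : ℝ :=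
  ∑ i, if θ ∈ S i then 0 else w i

theorem exists_disapproval_le {k N : ℕ} (hk : 1 ≤ k) (w : Fin N → ℝ) (S : Profile k N) :
    ∃ θ : Fin k, ∀ η : Fin k, disapproval w S θ ≤ disapproval w S η := by
  obtain ⟨θ, -, h⟩ := exists_min_image univ (disapproval w S) ⟨⟨0, hk⟩, mem_univ _⟩
  exact ⟨θ, fun η => h η (mem_univ _)⟩

/-- The multiplicative weights strategy: pick an option with the least disapproval, where an agent
dissatisfied `d` times so far has weight `(1 + ε) ^ d`. -/
noncomputable def weightsStrategy {k N T : ℕ} (hk : 1 ≤ k) (ε : ℝ) : Strategy k N T :=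
  fun _ h S => (exists_disapproval_le hk (fun i => (1 + ε) ^ pastDissatisfaction h i) S).choose

namespace Play

variable {k N T : ℕ}

/-- The dissatisfaction of agent `i` in the rounds with index below `t`. -/
def dissatisfactionBefore (p : Play k N T) (t : ℕ) (i : Fin N) : ℕ :=
  (univ.filter fun r : Fin T => (r : ℕ) < t ∧ p.choice r ∉ p.approved r i).card

theorem pastDissatisfaction_history (p : Play k N T) (r : Fin T) (i : Fin N) :
    pastDissatisfaction (p.history r) i = p.dissatisfactionBefore r i := by
  refine card_bij (fun j _ => j.castLE r.isLt.le) ?_ ?_ ?_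
  · intro j hj
    simp only [mem_filter, mem_univ, true_and] at hj ⊢
    exact ⟨j.isLt, hj⟩
  · intro a _ b _ h
    simpa [Fin.ext_iff] using h
  · intro s hs
    simp only [mem_filter, mem_univ, true_and] at hs
    exact ⟨⟨s, hs.1⟩, mem_filter.2 ⟨mem_univ _, hs.2⟩, rfl⟩

theorem dissatisfactionBefore_zero (p : Play k N T) (i : Fin N) :
    p.dissatisfactionBefore 0 i = 0 := by
  simp [dissatisfactionBefore]

theorem dissatisfactionBefore_self (p : Play k N T) (i : Fin N) :
    p.dissatisfactionBefore T i = p.dissatisfaction i := by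
  simp [dissatisfactionBefore, dissatisfaction]

theorem dissatisfactionBefore_le (p : Play k N T) (t : ℕ) (i : Fin N) :
    p.dissatisfactionBefore t i ≤ p.dissatisfaction i :=
  card_le_card fun r hr => by simp only [mem_filter] at hr ⊢; exact ⟨hr.1, hr.2.2⟩

theorem dissatisfactionBefore_succ (p : Play k N T) (r : Fin T) (i : Fin N) :
    p.dissatisfactionBefore (r + 1) i =
      p.dissatisfactionBefore r i + if p.choice r ∈ p.approved r i then 0 else 1 := by
  unfold dissatisfactionBefore
  split_ifs with h
  · rw [add_zero]
    congr 1
    ext s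
    simp only [mem_filter, mem_univ, true_and]
    refine ⟨fun ⟨h1, h2⟩ => ⟨?_, h2⟩, fun ⟨h1, h2⟩ => ⟨by omega, h2⟩⟩
    have : s ≠ r := by rintro rfl; exact h2 h
    have := Fin.val_ne_of_ne this
    omega
  · rw [← card_insert_of_notMem (a := r) (by simp)]
    congr 1
    ext s
    simp only [mem_filter, mem_univ, true_and, mem_insert, Fin.ext_iff]
    constructor
    · rintro ⟨h1, h2⟩
      by_cases hs : (s : ℕ) = r
      · exact Or.inl hs
      · exact Or.inr ⟨by omega, h2⟩
    · rintro (hs | ⟨h1, h2⟩)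
      · obtain rfl := Fin.ext hs
        exact ⟨by omega, h⟩
      · exact ⟨by omega, h2⟩

/-- The weight `(1 + ε) ^ d` of agent `i` before the round with index `t`, where `d` is the
dissatisfaction of `i` in the preceding rounds. -/
noncomputable def weight (p : Play k N T) (ε : ℝ) (t : ℕ) (i : Fin N) : ℝ :=
  (1 + ε) ^ p.dissatisfactionBefore t i

/-- The total weight of the agents dissatisfied in round `r`. -/
noncomputable def lostWeight (p : Play k N T) (ε : ℝ) (r : Fin T) : ℝ :=
  disapproval (p.weight ε r) (p.approved r) (p.choice r)

theorem weight_nonneg (p : Play k N T) {ε : ℝ} (hε : 0 ≤ ε) (t : ℕ) (i : Fin N) :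
    0 ≤ p.weight ε t i := by
  unfold weight; positivity

theorem weight_le_final (p : Play k N T) {ε : ℝ} (hε : 0 ≤ ε) (t : ℕ) (i : Fin N) :
    p.weight ε t i ≤ p.weight ε T i := by
  unfold weight
  rw [dissatisfactionBefore_self]
  exact pow_le_pow_right₀ (by linarith) (p.dissatisfactionBefore_le t i)

theorem lostWeight_nonneg (p : Play k N T) {ε : ℝ} (hε : 0 ≤ ε) (r : Fin T) :
    0 ≤ p.lostWeight ε r := by
  unfold lostWeight disapproval
  refine sum_nonneg fun i _ => ?_
  split_ifs
  exacts [le_rfl, p.weight_nonneg hε _ _]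

theorem sum_weight_succ (p : Play k N T) (ε : ℝ) (r : Fin T) :
    ∑ i, p.weight ε (r + 1) i = ∑ i, p.weight ε r i + ε * p.lostWeight ε r := by
  unfold lostWeight disapproval
  rw [mul_sum, ← sum_add_distrib]
  refine sum_congr rfl fun i _ => ?_
  unfold weight
  rw [dissatisfactionBefore_succ]
  split_ifs <;> ring

theorem sum_weight_final (p : Play k N T) (ε : ℝ) :
    ∑ i, p.weight ε T i = N + ε * ∑ r, p.lostWeight ε r := by
  have h : ∀ r : Fin T, ε * p.lostWeight ε r =
      (fun t : ℕ => ∑ i, p.weight ε (t + 1) i - ∑ i, p.weight ε t i) r := fun r => by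
    simp only [sum_weight_succ]; ring
  rw [mul_sum, sum_congr rfl fun r _ => h r,
    Fin.sum_univ_eq_sum_range (fun t : ℕ => ∑ i, p.weight ε (t + 1) i - ∑ i, p.weight ε t i),
    sum_range_sub (fun t : ℕ => ∑ i, p.weight ε t i)]
  simp [weight, dissatisfactionBefore_zero]

theorem Follows.lostWeight_le {p : Play k N T} {hk : 1 ≤ k} {ε : ℝ} (hε : 0 ≤ ε)
    (hp : p.Follows (weightsStrategy hk ε)) (r : Fin T) (η : Fin k) :
    p.lostWeight ε r ≤ disapproval (p.weight ε T) (p.approved r) η := by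
  have h := (exists_disapproval_le hk
    (fun i => (1 + ε) ^ pastDissatisfaction (p.history r) i) (p.approved r)).choose_spec η
  have hc : p.choice r = (exists_disapproval_le hk
    (fun i => (1 + ε) ^ pastDissatisfaction (p.history r) i) (p.approved r)).choose := hp r
  rw [← hc] at h
  simp only [pastDissatisfaction_history] at h
  refine h.trans (sum_le_sum fun i _ => ?_)
  split_ifs
  exacts [le_rfl, p.weight_le_final hε r i]

theorem conflictRounds_le {p : Play k N T} {C : ℕ} (hC : p.conflictNumber ≤ C)
    {A : Finset (Fin N)} (hA : A.card ≤ k) : p.conflictRounds A ≤ C :=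
  (le_sup (f := p.conflictRounds) (by simpa using hA)).trans hC

open Classical in
theorem Follows.lostWeight_pow_le {p : Play k N T} {hk : 1 ≤ k} {ε : ℝ} (hε : 0 ≤ ε)
    (hp : p.Follows (weightsStrategy hk ε)) (r : Fin T) :
    p.lostWeight ε r ^ k ≤ ∑ τ : Fin k → Fin N,
      (if p.InConflict (univ.image τ) r then 1 else 0) * ∏ θ, p.weight ε T (τ θ) := by
  calc p.lostWeight ε r ^ k = ∏ _θ : Fin k, p.lostWeight ε r := by simp
    _ ≤ ∏ θ, disapproval (p.weight ε T) (p.approved r) θ :=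
        prod_le_prod (fun _ _ => p.lostWeight_nonneg hε r) fun θ _ => hp.lostWeight_le hε r θ
    _ = ∑ τ : Fin k → Fin N, ∏ θ, if θ ∈ p.approved r (τ θ) then 0 else p.weight ε T (τ θ) := by
        unfold disapproval
        rw [prod_univ_sum, Fintype.piFinset_univ]
    _ ≤ _ := sum_le_sum fun τ _ => ?_
  by_cases h : ∃ θ, θ ∈ p.approved r (τ θ)
  · obtain ⟨θ, hθ⟩ := h
    rw [prod_eq_zero (i := θ) (mem_univ θ) (by simp [hθ])]
    exact mul_nonneg (by split_ifs <;> norm_num) (prod_nonneg fun _ _ => p.weight_nonneg hε _ _)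
  · push Not at h
    have hc : p.InConflict (univ.image τ) r := fun ⟨θ, hθ⟩ =>
      h θ (hθ _ (mem_image_of_mem τ (mem_univ θ)))
    simp [h, hc]

theorem Follows.sum_lostWeight_pow_le {p : Play k N T} {hk : 1 ≤ k} {ε : ℝ} (hε : 0 ≤ ε)
    (hp : p.Follows (weightsStrategy hk ε)) {C : ℕ} (hC : p.conflictNumber ≤ C) :
    ∑ r, p.lostWeight ε r ^ k ≤ C * (∑ i, p.weight ε T i) ^ k := by
  classical
  refine (sum_le_sum fun r _ => hp.lostWeight_pow_le hε r).trans ?_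
  rw [sum_comm, Fintype.sum_pow, mul_sum]
  refine sum_le_sum fun τ _ => ?_
  rw [← sum_mul]
  refine mul_le_mul_of_nonneg_right ?_ (prod_nonneg fun _ _ => p.weight_nonneg hε _ _)
  have h := conflictRounds_le hC (A := univ.image τ) (card_image_le.trans (by simp))
  rw [sum_boole]
  unfold conflictRounds at h
  exact_mod_cast h

/-- The bound on the weights. The hypothesis on `B` says that `B = T ^ (1 - 1 / k) * C ^ (1 / k)`. -/
theorem Follows.one_add_pow_dissatisfaction_le {p : Play k N T} {hk : 1 ≤ k} {ε B : ℝ}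
    (hε : 0 ≤ ε) (hp : p.Follows (weightsStrategy hk ε)) {C : ℕ} (hC : p.conflictNumber ≤ C)
    (hB : 0 ≤ B) (hBk : B ^ k = (T : ℝ) ^ (k - 1) * C) (hεB : ε * B ≤ 1 / 2) (i : Fin N) :
    (1 + ε) ^ p.dissatisfaction i ≤ 2 * N := by
  set W := ∑ i, p.weight ε T i
  have hW : 0 ≤ W := sum_nonneg fun i _ => p.weight_nonneg hε _ _
  have hL : ∑ r, p.lostWeight ε r ≤ B * W := by
    refine le_of_pow_le_pow_left₀ (n := k) (by omega) (by positivity) ?_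
    have h := pow_sum_le_card_mul_sum_pow (s := univ)
      (fun r _ => p.lostWeight_nonneg hε r) (k - 1)
    rw [Nat.sub_add_cancel hk, card_univ, Fintype.card_fin] at h
    calc (∑ r, p.lostWeight ε r) ^ k
        ≤ (T : ℝ) ^ (k - 1) * ∑ r, p.lostWeight ε r ^ k := h
      _ ≤ (T : ℝ) ^ (k - 1) * (C * W ^ k) := by
          gcongr
          exact hp.sum_lostWeight_pow_le hε hC
      _ = (B * W) ^ k := by rw [mul_pow, hBk, mul_assoc]
  have hWN : W ≤ 2 * N := by
    have h1 : W = N + ε * ∑ r, p.lostWeight ε r := p.sum_weight_final ε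
    have h2 := mul_le_mul_of_nonneg_left hL hε
    have h3 := mul_le_mul_of_nonneg_right hεB hW
    linarith
  have hi : p.weight ε T i ≤ W :=
    single_le_sum (f := p.weight ε T) (fun j _ => p.weight_nonneg hε _ _) (mem_univ i)
  rw [weight, dissatisfactionBefore_self] at hi
  exact hi.trans hWN

end Play

theorem exists_guarantees (k N T C : ℕ) (hk : 1 ≤ k) :
    ∃ σ : Strategy k N T, σ.Guarantees C
      (4 * ((T : ℝ) ^ (1 - 1 / (k : ℝ)) * (C : ℝ) ^ (1 / (k : ℝ))) * Real.log (2 * N)) := by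
  set B : ℝ := (T : ℝ) ^ (1 - 1 / (k : ℝ)) * (C : ℝ) ^ (1 / (k : ℝ)) with hBdef
  have hk0 : (k : ℝ) ≠ 0 := by positivity
  have hB : 0 ≤ B := by positivity
  have hBk : B ^ k = (T : ℝ) ^ (k - 1) * C := by
    rw [hBdef, mul_pow, ← Real.rpow_mul_natCast (by positivity),
      ← Real.rpow_mul_natCast (by positivity), one_div_mul_cancel hk0, Real.rpow_one, sub_mul,
      one_mul, one_div_mul_cancel hk0, ← Real.rpow_natCast, Nat.cast_sub hk, Nat.cast_one]
  rcases hB.eq_or_lt with h0 | hpos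
  · -- For `B = 0` no upper bound on `ε` is needed: a single dissatisfaction exceeds `2 * N`.
    refine ⟨weightsStrategy hk (2 * N), fun p hp hC i => ?_⟩
    have h := hp.one_add_pow_dissatisfaction_le (by positivity) hC hB hBk (by simp [← h0]) i
    have hd : p.dissatisfaction i = 0 := by
      by_contra hd
      have h1 : (1 + 2 * (N : ℝ)) ≤ (1 + 2 * N) ^ p.dissatisfaction i :=
        le_self_pow₀ (by linarith [N.cast_nonneg (α := ℝ)]) hd
      linarith
    simp [hd, ← h0]
  · have hB1 : 1 ≤ B := by
      have h : 0 < T ^ (k - 1) * C := by exact_mod_cast hBk ▸ pow_pos hpos k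
      by_contra! hlt
      have h1 : (1 : ℝ) ≤ (T : ℝ) ^ (k - 1) * C := by exact_mod_cast h
      linarith [pow_lt_one₀ hB hlt (n := k) (by omega)]
    refine ⟨weightsStrategy hk (1 / (2 * B)), fun p hp hC i => ?_⟩
    have h := hp.one_add_pow_dissatisfaction_le (by positivity) hC hB hBk
      (le_of_eq (by field_simp)) i
    have h1 := Real.log_le_log (by positivity) h
    rw [Real.log_pow] at h1
    have h2 : 1 / (4 * B) ≤ Real.log (1 + 1 / (2 * B)) := by
      refine le_trans ?_ (Real.one_sub_inv_le_log_of_pos (by positivity))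
      rw [show (1 : ℝ) - (1 + 1 / (2 * B))⁻¹ = 1 / (2 * B + 1) by field_simp; ring]
      exact one_div_le_one_div_of_le (by positivity) (by linarith)
    have h3 := (mul_le_mul_of_nonneg_left h2 (Nat.cast_nonneg _)).trans h1
    rw [mul_one_div, div_le_iff₀ (by positivity)] at h3
    linarith

theorem le_log_three : (1.09 : ℝ) ≤ Real.log 3 := by
  have h := Real.log_le_log (by norm_num) (show (2 : ℝ) ^ 19 ≤ 3 ^ 12 by norm_num)
  rw [Real.log_pow, Real.log_pow] at h
  push_cast at h
  linarith [Real.log_two_gt_d9]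

theorem two_le_of_one_lt_log_mul_log {m n : ℕ} (h : 1 < Real.log m * Real.log n) : 2 ≤ m := by
  by_contra! hlt
  interval_cases m <;> norm_num at h

/-- The product `log N * log C` has no values just above `1`. -/
theorem le_log_mul_log {N C : ℕ} (h : 1 < Real.log N * Real.log C) :
    1.09 ≤ Real.log N * Real.log C := by
  have l2 := Real.log_two_gt_d9
  have l2' := Real.log_two_lt_d9
  have l3 := le_log_three
  have l5 : 1.58 ≤ Real.log 5 := by
    have := Real.log_le_log (by norm_num) (show (2 : ℝ) ^ 16 ≤ 5 ^ 7 by norm_num)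
    rw [Real.log_pow, Real.log_pow] at this
    push_cast at this
    linarith
  have key : ∀ n : ℕ, 1 < Real.log n * Real.log 2 → 1.09 ≤ Real.log n * Real.log 2 := by
    intro n hn
    have h5 : 5 ≤ n := by
      by_contra! hlt
      have hn0 : n ≠ 0 := by rintro rfl; norm_num at hn
      have h4 : Real.log n ≤ Real.log (2 ^ 2) :=
        Real.log_le_log (by positivity) (by norm_num; exact_mod_cast (by omega : n ≤ 4))
      rw [Real.log_pow] at h4
      push_cast at h4
      nlinarith
    have : Real.log 5 ≤ Real.log n := Real.log_le_log (by norm_num) (by exact_mod_cast h5)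
    nlinarith
  have hN := two_le_of_one_lt_log_mul_log h
  have hC := two_le_of_one_lt_log_mul_log (mul_comm (Real.log N) _ ▸ h)
  rcases hN.eq_or_lt with rfl | hN3
  · rw [mul_comm] at h ⊢
    exact key C h
  rcases hC.eq_or_lt with rfl | hC3
  · exact key N h
  have h1 : Real.log 3 ≤ Real.log N := Real.log_le_log (by norm_num) (by exact_mod_cast hN3)
  have h2 : Real.log 3 ≤ Real.log C := Real.log_le_log (by norm_num) (by exact_mod_cast hC3)
  nlinarith

theorem mul_le_pow_forty {z : ℝ} (hz : 1.09 ≤ z) : 12 * z ≤ z ^ 40 := by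
  have h : (12 : ℝ) ≤ z ^ 39 :=
    le_trans (by norm_num) (pow_le_pow_left₀ (by norm_num) hz 39)
  calc 12 * z ≤ z ^ 39 * z := mul_le_mul_of_nonneg_right h (by linarith)
    _ = z ^ 40 := by ring

end PerpetualVoting

theorem theorem1 (k : ℕ) (hk : 1 ≤ k) :
    ∃ W : ℝ, 0 < W ∧ ∀ N T C : ℕ, ∃ σ : PerpetualVoting.Strategy k N T,
      PerpetualVoting.Strategy.Guarantees σ C
        ((T : ℝ) ^ (1 - 1 / (k : ℝ)) * (C : ℝ) ^ (1 / (k : ℝ)) *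
          (Real.log ((N : ℝ) + 2) * Real.log ((C : ℝ) + 2)) ^ W) ∧
      (1 < Real.log (N : ℝ) * Real.log (C : ℝ) →
        PerpetualVoting.Strategy.Guarantees σ C
          ((T : ℝ) ^ (1 - 1 / (k : ℝ)) * (C : ℝ) ^ (1 / (k : ℝ)) *
            (Real.log (N : ℝ) * Real.log (C : ℝ)) ^ W)) := by
  refine ⟨40, by norm_num, fun N T C => ?_⟩
  obtain ⟨σ, hσ⟩ := PerpetualVoting.exists_guarantees k N T C hk
  set B : ℝ := (T : ℝ) ^ (1 - 1 / (k : ℝ)) * (C : ℝ) ^ (1 / (k : ℝ)) with hBdef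
  have hB : 0 ≤ B := by positivity
  have absorb : ∀ z : ℝ, 1.09 ≤ z → Real.log (2 * N) ≤ 3 * z →
      4 * B * Real.log (2 * N) ≤ B * z ^ (40 : ℝ) := by
    intro z hz hlog
    have h := PerpetualVoting.mul_le_pow_forty hz
    rw [show (40 : ℝ) = ((40 : ℕ) : ℝ) by norm_num, Real.rpow_natCast]
    calc 4 * B * Real.log (2 * N) = B * (4 * Real.log (2 * N)) := by ring
      _ ≤ B * z ^ 40 := mul_le_mul_of_nonneg_left (by linarith) hB
  refine ⟨σ, fun p hp hC i => (hσ p hp hC i).trans ?_, fun h p hp hC i =>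
    (hσ p hp hC i).trans (absorb _ (PerpetualVoting.le_log_mul_log h) ?_)⟩
  · rcases Nat.eq_zero_or_pos C with rfl | hCpos
    · -- The logarithmic factor may be below `1` for `C = 0`, but then `B` vanishes.
      have h0 : B = 0 := by
        rw [hBdef, Nat.cast_zero, Real.zero_rpow (by positivity), mul_zero]
      simp [h0]
    have hN1 : (1 : ℝ) ≤ N := by exact_mod_cast i.pos
    have hC1 : (1 : ℝ) ≤ C := by exact_mod_cast hCpos
    have h3 := PerpetualVoting.le_log_three
    have hx : Real.log 3 ≤ Real.log (N + 2) := Real.log_le_log (by norm_num) (by linarith)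
    have hy : Real.log 3 ≤ Real.log (C + 2) := Real.log_le_log (by norm_num) (by linarith)
    have hl : Real.log (2 * N) ≤ Real.log ((N + 2) ^ 2) :=
      Real.log_le_log (by positivity) (by nlinarith)
    rw [Real.log_pow] at hl
    push_cast at hl
    exact absorb _ (by nlinarith) (by nlinarith)
  · have hN2 : (2 : ℝ) ≤ N := by
      exact_mod_cast PerpetualVoting.two_le_of_one_lt_log_mul_log h
    have hC2 : (2 : ℝ) ≤ C := by
      exact_mod_cast PerpetualVoting.two_le_of_one_lt_log_mul_log (mul_comm (Real.log N) _ ▸ h)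
    have l2 := Real.log_two_gt_d9
    have hx : Real.log 2 ≤ Real.log N := Real.log_le_log (by norm_num) hN2
    have hy : Real.log 2 ≤ Real.log C := Real.log_le_log (by norm_num) hC2
    rw [Real.log_mul (by norm_num) (by positivity)]
    nlinarith
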